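/- Let $\Bbbk$ be a field, $A$ an associative unital $\Bbbk$-algebra and $\Gamma\subseteq A$ a $\Bbbk$-subalgebra. Let $\mathrm{cfs}(\Gamma)$ be the set of maximal two-sided ideals $\mathfrak m$ of $\Gamma$ with $\dim_\Bbbk\Gamma/\mathfrak m<\infty$, let $\sim$ be an arbitrary equivalence relation on $\mathrm{cfs}(\Gamma)$, and call its classes blocks. For a block $B$ let $W(B)$ be the set of all finite products $\mathfrak m_1\cdots\mathfrak m_k$ ($k\ge 0$, $\mathfrak m_i\in B$; the empty product is $\Gamma$). For a $\Gamma$-module $V$ put $V(B)=\{v\in V:\mathfrak m v=0\text{ for some }\mathfrak m\in W(B)\}$ and $\mathrm{Supp}(V)=\{B: V(B)\ne 0\}$. Call $V$ a block module if $V=\bigoplus_{B}V(B)$, and a strong block module if moreover for every block $B$ there is $\mathfrak m\in W(B)$ with $\mathfrak m V(B)=0$; use the same definitions for right modules. A Harish-Chandra block module is an $A$-module which is a block module over $\Gamma$. The subalgebra $\Gamma$ is a strong Harish-Chandra block subalgebra of $A$ if, for every block $B$ and every $\mathfrak m\in W(B)$, the left module $A/A\mathfrak m$ and the right module $A/\mathfrak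 m A$ are strong block modules over $\Gamma$. For a block $B$ let $\hat\Gamma_B=\varprojlim_{\mathfrak m\in W(B)}\Gamma/\mathfrak m$ and $$\mathcal A(B,B)=\varprojlim_{\mathfrak n,\mathfrak m\in W(B)}\frac{A}{\mathfrak n A+A\mathfrak m}$$ (limits over inclusions), where $\hat\Gamma_B$ acts on $\mathcal A(B,B)$ on the left and on the right componentwise by $(\gamma\alpha)_{\mathfrak n,\mathfrak m}=\gamma_{\mathfrak n}\alpha_{\mathfrak n,\mathfrak m}$ and $(\alpha\gamma)_{\mathfrak n,\mathfrak m}=\alpha_{\mathfrak n,\mathfrak m}\gamma_{\mathfrak m}$. **Theorem.** Let $\Gamma$ be (left and right) noetherian and a strong Harish-Chandra block subalgebra of $A$ with respect to $\sim$. Let $B$ be a block which is a finite set, and suppose that $\mathcal A(B,B)$ is finitely generated both as a left and as a right $\hat\Gamma_B$-module. Then: (i) there are only finitely many isomorphism classes of simple Harish-Chandra block modules $V$ with $B\in\mathrm{Supp}(V)$; (ii) for every simple Harish-Chandra block module $V$, the space $V(B)$ is finite-dimensional over $\Bbbk$. -/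

import Mathlib

universe u v w

namespace HCBlock

section Blocks

variable {k : Type*} [Field k] {R : Type*} [Ring R] [Algebra k R]

/-- `m` is a maximal two-sided ideal of the `k`-algebra `R`, of finite codimension over `k`. -/
def IsCfs (k : Type*) [Field k] {R : Type*} [Ring R] [Algebra k R] (m : Ideal R) : Prop :=
  m.IsTwoSided ∧ m ≠ ⊤ ∧ (∀ J : Ideal R, J.IsTwoSided → m ≤ J → J ≠ ⊤ → J = m) ∧
    Module.Finite k (R ⧸ m)

/-- The set `cfs(R)` of cofinite maximal two-sided ideals. -/
abbrev Cfs (k : Type*) [Field k] (R : Type*) [Ring R] [Algebra k R] : Type _ :=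
  {m : Ideal R // IsCfs k m}

/-- The product ideal `m₁ ⋯ mⱼ` of a list of cofinite maximal ideals; the empty product is `R`. -/
def wordProd : List (Cfs k R) → Ideal R
  | [] => ⊤
  | m :: l => m.1 * wordProd l

/-- The set of all finite products of members of the block `B`. -/
def words (s : Setoid (Cfs k R)) (B : Quotient s) : Set (Ideal R) :=
  {I | ∃ l : List (Cfs k R), (∀ m ∈ l, (Quotient.mk s m) = B) ∧ wordProd l = I}

/-- The products of members of `B`, as a type (ordered by inclusion of ideals). -/
abbrev Word (s : Setoid (Cfs k R)) (B : Quotient s) : Type _ := {I : Ideal R // I ∈ words s B}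

theorem wordProd_isTwoSided (l : List (Cfs k R)) : (wordProd l).IsTwoSided := by
  induction l with
  | nil => exact inferInstanceAs (⊤ : Ideal R).IsTwoSided
  | cons m l ih =>
    have := m.2.1
    have := ih
    exact inferInstanceAs (m.1 * wordProd l).IsTwoSided

instance word_isTwoSided (s : Setoid (Cfs k R)) (B : Quotient s) (I : Word s B) : I.1.IsTwoSided := by
  obtain ⟨I, l, -, rfl⟩ := I
  exact wordProd_isTwoSided l

theorem wordProd_append_le_left (l l' : List (Cfs k R)) :
    wordProd (l ++ l') ≤ wordProd l := by
  induction l with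
  | nil => exact le_top
  | cons m l ih => exact Ideal.mul_mono_right ih

theorem wordProd_append_le_right (l l' : List (Cfs k R)) :
    wordProd (l ++ l') ≤ wordProd l' := by
  induction l with
  | nil => exact le_rfl
  | cons m l ih => exact le_trans Ideal.mul_le_right ih

theorem exists_word_le (s : Setoid (Cfs k R)) (B : Quotient s) {I J : Ideal R}
    (hI : I ∈ words s B) (hJ : J ∈ words s B) : ∃ K ∈ words s B, K ≤ I ∧ K ≤ J := by
  obtain ⟨l, hl, rfl⟩ := hI
  obtain ⟨l', hl', rfl⟩ := hJ
  refine ⟨_, ⟨l ++ l', ?_, rfl⟩, wordProd_append_le_left l l', wordProd_append_le_right l l'⟩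
  intro m hm
  rcases List.mem_append.1 hm with h | h
  exacts [hl m h, hl' m h]

/-- The block space `V(B)` of a left `R`-module `V`: the vectors killed by some product of
members of `B`. -/
def blockSpace (s : Setoid (Cfs k R)) (V : Type*) [AddCommGroup V] [Module R V]
    (B : Quotient s) : Submodule R V where
  carrier := {v | ∃ I ∈ words s B, ∀ x ∈ I, x • v = 0}
  zero_mem' := ⟨⊤, ⟨[], by simp, rfl⟩, fun x _ => smul_zero x⟩
  add_mem' := by
    rintro v w ⟨I, hI, hv⟩ ⟨J, hJ, hw⟩
    obtain ⟨K, hK, hKI, hKJ⟩ := exists_word_le s B hI hJ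
    exact ⟨K, hK, fun x hx => by rw [smul_add, hv x (hKI hx), hw x (hKJ hx), add_zero]⟩
  smul_mem' := by
    rintro c v ⟨I, hI, hv⟩
    have : I.IsTwoSided := word_isTwoSided s B ⟨I, hI⟩
    exact ⟨I, hI, fun x hx => by rw [← mul_smul]; exact hv _ (I.mul_mem_right c hx)⟩

/-- The support `Supp(V)`. -/
def supp (s : Setoid (Cfs k R)) (V : Type*) [AddCommGroup V] [Module R V] : Set (Quotient s) :=
  {B | blockSpace s V B ≠ ⊥}

open Classical in
/-- `V` is a block module: it is the (internal) direct sum of its block spaces. -/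
def IsBlockModule (s : Setoid (Cfs k R)) (V : Type*) [AddCommGroup V] [Module R V] : Prop :=
  DirectSum.IsInternal (fun B : Quotient s => blockSpace s V B)

/-- `V` is a strong block module: a block module each of whose block spaces `V(B)` is killed by a
single product of members of `B`. -/
def IsStrongBlockModule (s : Setoid (Cfs k R)) (V : Type*) [AddCommGroup V] [Module R V] : Prop :=
  IsBlockModule s V ∧
    ∀ B : Quotient s, ∃ I ∈ words s B, ∀ x ∈ I, ∀ v ∈ blockSpace s V B, x • v = 0

/-- The compatible families in the product of all `R/I`, `I` a product of members of `B`. -/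
def completionSubring (s : Setoid (Cfs k R)) (B : Quotient s) :
    Subring (∀ I : Word s B, R ⧸ I.1) where
  carrier := {x | ∀ (I J : Word s B) (h : I.1 ≤ J.1), Ideal.Quotient.factor h (x I) = x J}
  zero_mem' := fun I J h => by simp
  one_mem' := fun I J h => by simp
  add_mem' := fun {x y} hx hy I J h => by simp [hx I J h, hy I J h]
  mul_mem' := fun {x y} hx hy I J h => by simp [hx I J h, hy I J h]
  neg_mem' := fun {x} hx I J h => by simp [hx I J h]

/-- The completion `lim R/I` of `R` at the block `B`, over all products `I` of members of `B`. -/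
def Completion (s : Setoid (Cfs k R)) (B : Quotient s) : Type _ := completionSubring s B

instance (s : Setoid (Cfs k R)) (B : Quotient s) : Ring (Completion s B) :=
  inferInstanceAs (Ring (completionSubring s B))

/-- The component of an element of the completion in `R/I`. -/
def Completion.comp {s : Setoid (Cfs k R)} {B : Quotient s} (x : Completion s B) (I : Word s B) :
    R ⧸ I.1 :=
  x.1 I

end Blocks

section Subalgebra

variable {k : Type*} [Field k] {A : Type*} [Ring A] [Algebra k A]

/-- An `A`-module is a Harish-Chandra block module if it is a block module over `Γ`. -/
def IsHCBlockModule (Γ : Subalgebra k A) (s : Setoid (Cfs k Γ)) (V : Type*) [AddCommGroup V]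
    [Module A V] : Prop :=
  IsBlockModule (R := Γ) s V

/-- The block space of a right `A`-module `V` (a left module over `Aᵐᵒᵖ`), as an additive
subgroup: the vectors `v` with `v I = 0` for some product `I` of members of `B`. -/
def rightBlockSpace (Γ : Subalgebra k A) (s : Setoid (Cfs k Γ)) (V : Type*) [AddCommGroup V]
    [Module Aᵐᵒᵖ V] (B : Quotient s) : AddSubgroup V where
  carrier := {v | ∃ I ∈ words s B, ∀ x ∈ I, MulOpposite.op (x : A) • v = 0}
  zero_mem' := ⟨⊤, ⟨[], by simp, rfl⟩, fun x _ => smul_zero _⟩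
  add_mem' := by
    rintro v w ⟨I, hI, hv⟩ ⟨J, hJ, hw⟩
    obtain ⟨K, hK, hKI, hKJ⟩ := exists_word_le s B hI hJ
    exact ⟨K, hK, fun x hx => by rw [smul_add, hv x (hKI hx), hw x (hKJ hx), add_zero]⟩
  neg_mem' := by
    rintro v ⟨I, hI, hv⟩
    exact ⟨I, hI, fun x hx => by rw [smul_neg, hv x hx, neg_zero]⟩

open Classical in
/-- The right-handed version of `IsStrongBlockModule`, for a right `A`-module. -/
def IsRightStrongBlockModule (Γ : Subalgebra k A) (s : Setoid (Cfs k Γ)) (V : Type*)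
    [AddCommGroup V] [Module Aᵐᵒᵖ V] : Prop :=
  DirectSum.IsInternal (fun B : Quotient s => rightBlockSpace Γ s V B) ∧
    ∀ B : Quotient s, ∃ I ∈ words s B, ∀ x ∈ I, ∀ v ∈ rightBlockSpace Γ s V B,
      MulOpposite.op (x : A) • v = 0

/-- The left ideal `A m` of `A` generated by `m ⊆ Γ`. -/
def leftIdeal (Γ : Subalgebra k A) (m : Ideal Γ) : Submodule A A :=
  Submodule.span A ((fun x : Γ => (x : A)) '' (m : Set Γ))

/-- The right ideal `m A` of `A` generated by `m ⊆ Γ`. -/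
def rightIdeal (Γ : Subalgebra k A) (m : Ideal Γ) : Submodule Aᵐᵒᵖ A :=
  Submodule.span Aᵐᵒᵖ ((fun x : Γ => (x : A)) '' (m : Set Γ))

/-- `Γ` is a strong Harish-Chandra block subalgebra of `A` with respect to `s`. -/
def IsStrongHCBlockSubalgebra (Γ : Subalgebra k A) (s : Setoid (Cfs k Γ)) : Prop :=
  (∀ B : Quotient s, ∀ m ∈ words s B, IsStrongBlockModule (R := Γ) s (A ⧸ leftIdeal Γ m)) ∧
    (∀ C : Quotient s, ∀ l ∈ words s C, IsRightStrongBlockModule Γ s (A ⧸ rightIdeal Γ l))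

/-- The subspace `n A + A m` of `A`. -/
def twoSum (Γ : Subalgebra k A) (n m : Ideal Γ) : Submodule k A :=
  (n.restrictScalars k).map Γ.val.toLinearMap * ⊤ ⊔ ⊤ * (m.restrictScalars k).map Γ.val.toLinearMap

theorem twoSum_mono (Γ : Subalgebra k A) {n n' m m' : Ideal Γ} (hn : n ≤ n') (hm : m ≤ m') :
    twoSum Γ n m ≤ twoSum Γ n' m' :=
  sup_le_sup (mul_le_mul' (Submodule.map_mono hn) le_rfl)
    (mul_le_mul' le_rfl (Submodule.map_mono hm))

theorem mul_mem_twoSum_of_left (Γ : Subalgebra k A) {n m : Ideal Γ} {x : Γ} (hx : x ∈ n) (a : A) :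
    (x : A) * a ∈ twoSum Γ n m :=
  Submodule.mem_sup_left
    (Submodule.mul_mem_mul (Submodule.mem_map_of_mem hx) Submodule.mem_top)

theorem mul_mem_twoSum_of_right (Γ : Subalgebra k A) {n m : Ideal Γ} {x : Γ} (hx : x ∈ m) (a : A) :
    a * (x : A) ∈ twoSum Γ n m :=
  Submodule.mem_sup_right
    (Submodule.mul_mem_mul Submodule.mem_top (Submodule.mem_map_of_mem hx))

theorem twoSum_induction (Γ : Subalgebra k A) {n m : Ideal Γ} (P : Submodule k A)
    (hl : ∀ x ∈ n, ∀ a : A, (x : A) * a ∈ P) (hr : ∀ x ∈ m, ∀ a : A, a * (x : A) ∈ P) :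
    twoSum Γ n m ≤ P := by
  refine sup_le (Submodule.mul_le.2 ?_) (Submodule.mul_le.2 ?_)
  · rintro _ ⟨x, hx, rfl⟩ a -
    exact hl x hx a
  · rintro a - _ ⟨x, hx, rfl⟩
    exact hr x hx a

theorem twoSum_mul_left (Γ : Subalgebra k A) (n m : Ideal Γ) (g : Γ) :
    twoSum Γ n m ≤ (twoSum Γ n m).comap (LinearMap.mulLeft k (g : A)) := by
  refine twoSum_induction Γ _ (fun x hx a => ?_) (fun x hx a => ?_)
  · have := mul_mem_twoSum_of_left Γ (m := m) (n.mul_mem_left g hx) a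
    simpa [mul_assoc] using this
  · have := mul_mem_twoSum_of_right Γ (n := n) hx ((g : A) * a)
    simpa [mul_assoc] using this

theorem twoSum_mul_right (Γ : Subalgebra k A) (n m : Ideal Γ) [m.IsTwoSided] (g : Γ) :
    twoSum Γ n m ≤ (twoSum Γ n m).comap (LinearMap.mulRight k (g : A)) := by
  refine twoSum_induction Γ _ (fun x hx a => ?_) (fun x hx a => ?_)
  · have := mul_mem_twoSum_of_left Γ (m := m) hx (a * (g : A))
    simpa [mul_assoc] using this
  · have := mul_mem_twoSum_of_right Γ (n := n) (m.mul_mem_right g hx) a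
    simpa [mul_assoc] using this

/-- The quotient `A/(nA + Am)`. -/
def TwoQuot (Γ : Subalgebra k A) (n m : Ideal Γ) : Type _ := A ⧸ twoSum Γ n m

instance (Γ : Subalgebra k A) (n m : Ideal Γ) : AddCommGroup (TwoQuot Γ n m) :=
  inferInstanceAs (AddCommGroup (A ⧸ twoSum Γ n m))

instance (Γ : Subalgebra k A) (n m : Ideal Γ) : Module k (TwoQuot Γ n m) :=
  inferInstanceAs (Module k (A ⧸ twoSum Γ n m))

/-- The quotient map `A → A/(nA + Am)`. -/
def twoMk (Γ : Subalgebra k A) (n m : Ideal Γ) : A →ₗ[k] TwoQuot Γ n m := (twoSum Γ n m).mkQ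

theorem twoMk_surjective (Γ : Subalgebra k A) (n m : Ideal Γ) :
    Function.Surjective (twoMk Γ n m) :=
  Submodule.mkQ_surjective _

theorem twoMk_eq_zero (Γ : Subalgebra k A) (n m : Ideal Γ) {a : A} :
    twoMk Γ n m a = 0 ↔ a ∈ twoSum Γ n m :=
  Submodule.Quotient.mk_eq_zero _

/-- The action of `γ ∈ Γ` on `A/(nA + Am)` by left multiplication. -/
def lmul (Γ : Subalgebra k A) (n m : Ideal Γ) (g : Γ) : TwoQuot Γ n m →ₗ[k] TwoQuot Γ n m :=
  (twoSum Γ n m).mapQ (twoSum Γ n m) (LinearMap.mulLeft k (g : A)) (twoSum_mul_left Γ n m g)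

/-- The action of `γ ∈ Γ` on `A/(nA + Am)` by right multiplication. -/
def rmul (Γ : Subalgebra k A) (n m : Ideal Γ) [m.IsTwoSided] (g : Γ) :
    TwoQuot Γ n m →ₗ[k] TwoQuot Γ n m :=
  (twoSum Γ n m).mapQ (twoSum Γ n m) (LinearMap.mulRight k (g : A)) (twoSum_mul_right Γ n m g)

theorem lmul_mk (Γ : Subalgebra k A) (n m : Ideal Γ) (g : Γ) (a : A) :
    lmul Γ n m g (twoMk Γ n m a) = twoMk Γ n m ((g : A) * a) := rfl

theorem rmul_mk (Γ : Subalgebra k A) (n m : Ideal Γ) [m.IsTwoSided] (g : Γ) (a : A) :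
    rmul Γ n m g (twoMk Γ n m a) = twoMk Γ n m (a * (g : A)) := rfl

/-- The left action of `Γ/n` on `A/(nA + Am)`. -/
def leftAct (Γ : Subalgebra k A) (n m : Ideal Γ) [n.IsTwoSided] :
    (Γ ⧸ n) →+ TwoQuot Γ n m →+ TwoQuot Γ n m :=
  QuotientAddGroup.lift n.toAddSubgroup
    (AddMonoidHom.mk' (fun g => (lmul Γ n m g).toAddMonoidHom) fun g h => by
      ext x
      obtain ⟨a, rfl⟩ := twoMk_surjective Γ n m x
      change twoMk Γ n m (((g + h : Γ) : A) * a) =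
        twoMk Γ n m ((g : A) * a) + twoMk Γ n m ((h : A) * a)
      rw [← map_add, ← add_mul]; rfl)
    fun g hg => by
      ext x
      obtain ⟨a, rfl⟩ := twoMk_surjective Γ n m x
      exact (twoMk_eq_zero Γ n m).2 (mul_mem_twoSum_of_left Γ hg a)

/-- The right action of `Γ/m` on `A/(nA + Am)`. -/
def rightAct (Γ : Subalgebra k A) (n m : Ideal Γ) [m.IsTwoSided] :
    (Γ ⧸ m) →+ TwoQuot Γ n m →+ TwoQuot Γ n m :=
  QuotientAddGroup.lift m.toAddSubgroup
    (AddMonoidHom.mk' (fun g => (rmul Γ n m g).toAddMonoidHom) fun g h => by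
      ext x
      obtain ⟨a, rfl⟩ := twoMk_surjective Γ n m x
      change twoMk Γ n m (a * ((g + h : Γ) : A)) =
        twoMk Γ n m (a * (g : A)) + twoMk Γ n m (a * (h : A))
      rw [← map_add, ← mul_add]; rfl)
    fun g hg => by
      ext x
      obtain ⟨a, rfl⟩ := twoMk_surjective Γ n m x
      exact (twoMk_eq_zero Γ n m).2 (mul_mem_twoSum_of_right Γ hg a)

theorem leftAct_mk (Γ : Subalgebra k A) (n m : Ideal Γ) [n.IsTwoSided] (g : Γ) (a : A) :
    leftAct Γ n m (Ideal.Quotient.mk n g) (twoMk Γ n m a) = twoMk Γ n m ((g : A) * a) := rfl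

theorem rightAct_mk (Γ : Subalgebra k A) (n m : Ideal Γ) [m.IsTwoSided] (g : Γ) (a : A) :
    rightAct Γ n m (Ideal.Quotient.mk m g) (twoMk Γ n m a) = twoMk Γ n m (a * (g : A)) := rfl

theorem leftAct_one (Γ : Subalgebra k A) (n m : Ideal Γ) [n.IsTwoSided] (x : TwoQuot Γ n m) :
    leftAct Γ n m 1 x = x := by
  obtain ⟨a, rfl⟩ := twoMk_surjective Γ n m x
  rw [← map_one (Ideal.Quotient.mk n), leftAct_mk, OneMemClass.coe_one, one_mul]

theorem rightAct_one (Γ : Subalgebra k A) (n m : Ideal Γ) [m.IsTwoSided] (x : TwoQuot Γ n m) :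
    rightAct Γ n m 1 x = x := by
  obtain ⟨a, rfl⟩ := twoMk_surjective Γ n m x
  rw [← map_one (Ideal.Quotient.mk m), rightAct_mk, OneMemClass.coe_one, mul_one]

theorem leftAct_mul (Γ : Subalgebra k A) (n m : Ideal Γ) [n.IsTwoSided] (g h : Γ ⧸ n)
    (x : TwoQuot Γ n m) : leftAct Γ n m (g * h) x = leftAct Γ n m g (leftAct Γ n m h x) := by
  obtain ⟨a, rfl⟩ := twoMk_surjective Γ n m x
  obtain ⟨g, rfl⟩ := Ideal.Quotient.mk_surjective g
  obtain ⟨h, rfl⟩ := Ideal.Quotient.mk_surjective h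
  rw [← map_mul, leftAct_mk, leftAct_mk, leftAct_mk, MulMemClass.coe_mul, mul_assoc]

theorem rightAct_mul (Γ : Subalgebra k A) (n m : Ideal Γ) [m.IsTwoSided] (g h : Γ ⧸ m)
    (x : TwoQuot Γ n m) : rightAct Γ n m (g * h) x = rightAct Γ n m h (rightAct Γ n m g x) := by
  obtain ⟨a, rfl⟩ := twoMk_surjective Γ n m x
  obtain ⟨g, rfl⟩ := Ideal.Quotient.mk_surjective g
  obtain ⟨h, rfl⟩ := Ideal.Quotient.mk_surjective h
  rw [← map_mul, rightAct_mk, rightAct_mk, rightAct_mk, MulMemClass.coe_mul, mul_assoc]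

/-- The canonical map `A/(nA + Am) → A/(n'A + Am')` for `n ⊆ n'`, `m ⊆ m'`. -/
def trans (Γ : Subalgebra k A) {n n' m m' : Ideal Γ} (hn : n ≤ n') (hm : m ≤ m') :
    TwoQuot Γ n m →ₗ[k] TwoQuot Γ n' m' :=
  Submodule.factor (twoSum_mono Γ hn hm)

theorem trans_mk (Γ : Subalgebra k A) {n n' m m' : Ideal Γ} (hn : n ≤ n') (hm : m ≤ m') (a : A) :
    trans Γ hn hm (twoMk Γ n m a) = twoMk Γ n' m' a := rfl

theorem trans_leftAct (Γ : Subalgebra k A) {n n' m m' : Ideal Γ} [n.IsTwoSided] [n'.IsTwoSided]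
    (hn : n ≤ n') (hm : m ≤ m') (g : Γ ⧸ n) (x : TwoQuot Γ n m) :
    trans Γ hn hm (leftAct Γ n m g x) =
      leftAct Γ n' m' (Ideal.Quotient.factor hn g) (trans Γ hn hm x) := by
  obtain ⟨g, rfl⟩ := Ideal.Quotient.mk_surjective g
  obtain ⟨a, rfl⟩ := twoMk_surjective Γ n m x
  rw [leftAct_mk, trans_mk, trans_mk, Ideal.Quotient.factor_mk, leftAct_mk]

theorem trans_rightAct (Γ : Subalgebra k A) {n n' m m' : Ideal Γ} [m.IsTwoSided] [m'.IsTwoSided]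
    (hn : n ≤ n') (hm : m ≤ m') (g : Γ ⧸ m) (x : TwoQuot Γ n m) :
    trans Γ hn hm (rightAct Γ n m g x) =
      rightAct Γ n' m' (Ideal.Quotient.factor hm g) (trans Γ hn hm x) := by
  obtain ⟨g, rfl⟩ := Ideal.Quotient.mk_surjective g
  obtain ⟨a, rfl⟩ := twoMk_surjective Γ n m x
  rw [rightAct_mk, trans_mk, trans_mk, Ideal.Quotient.factor_mk, rightAct_mk]

/-- The compatible families in the product of all `A/(nA + Am)`, for `n` a product of members of
`C` and `m` a product of members of `B`. -/
def homSubmodule (Γ : Subalgebra k A) (s : Setoid (Cfs k Γ)) (B C : Quotient s) :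
    Submodule k (∀ (n : Word s C) (m : Word s B), TwoQuot Γ n.1 m.1) where
  carrier := {α | ∀ (n n' : Word s C) (m m' : Word s B) (hn : n.1 ≤ n'.1) (hm : m.1 ≤ m'.1),
    trans Γ hn hm (α n m) = α n' m'}
  zero_mem' := fun n n' m m' hn hm => map_zero _
  add_mem' := fun {α β} hα hβ n n' m m' hn hm => by
    rw [Pi.add_apply, Pi.add_apply, Pi.add_apply, Pi.add_apply, map_add, hα n n' m m' hn hm,
      hβ n n' m m' hn hm]
  smul_mem' := fun c α hα n n' m m' hn hm => by
    rw [Pi.smul_apply, Pi.smul_apply, Pi.smul_apply, Pi.smul_apply, map_smul,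
      hα n n' m m' hn hm]

/-- The morphism space `𝒜(B, C) = lim A/(nA + Am)`. -/
def HomSpace (Γ : Subalgebra k A) (s : Setoid (Cfs k Γ)) (B C : Quotient s) : Type _ :=
  homSubmodule Γ s B C

instance (Γ : Subalgebra k A) (s : Setoid (Cfs k Γ)) (B C : Quotient s) :
    AddCommGroup (HomSpace Γ s B C) :=
  inferInstanceAs (AddCommGroup (homSubmodule Γ s B C))

instance (Γ : Subalgebra k A) (s : Setoid (Cfs k Γ)) (B C : Quotient s) :
    Module k (HomSpace Γ s B C) :=
  inferInstanceAs (Module k (homSubmodule Γ s B C))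

/-- The component of `α ∈ 𝒜(B, C)` in `A/(nA + Am)`. -/
def HomSpace.comp {Γ : Subalgebra k A} {s : Setoid (Cfs k Γ)} {B C : Quotient s}
    (α : HomSpace Γ s B C) (n : Word s C) (m : Word s B) : TwoQuot Γ n.1 m.1 :=
  α.1 n m

theorem HomSpace.ext {Γ : Subalgebra k A} {s : Setoid (Cfs k Γ)} {B C : Quotient s}
    {α β : HomSpace Γ s B C} (h : ∀ n m, α.comp n m = β.comp n m) : α = β :=
  Subtype.ext (funext fun n => funext fun m => h n m)

/-- The left action of the completion at `C` on `𝒜(B, C)`: `(γ α)_{n,m} = γ_n α_{n,m}`. -/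
instance homSpaceLeftModule (Γ : Subalgebra k A) (s : Setoid (Cfs k Γ)) (B C : Quotient s) :
    Module (Completion s C) (HomSpace Γ s B C) where
  smul γ α := ⟨fun n m => leftAct Γ n.1 m.1 (γ.comp n) (α.comp n m), fun n n' m m' hn hm =>
    (trans_leftAct Γ hn hm _ _).trans
      (congrArg₂ (fun g x => leftAct Γ n'.1 m'.1 g x) (γ.2 n n' hn) (α.2 n n' m m' hn hm))⟩
  one_smul α := HomSpace.ext fun n m => leftAct_one Γ n.1 m.1 (α.comp n m)
  mul_smul γ δ α := HomSpace.ext fun n m =>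
    leftAct_mul Γ n.1 m.1 (γ.comp n) (δ.comp n) (α.comp n m)
  smul_zero γ := HomSpace.ext fun n m => map_zero (leftAct Γ n.1 m.1 (γ.comp n))
  smul_add γ α β := HomSpace.ext fun n m =>
    map_add (leftAct Γ n.1 m.1 (γ.comp n)) (α.comp n m) (β.comp n m)
  add_smul γ δ α := HomSpace.ext fun n m =>
    DFunLike.congr_fun (map_add (leftAct Γ n.1 m.1) (γ.comp n) (δ.comp n)) (α.comp n m)
  zero_smul α := HomSpace.ext fun n m =>
    DFunLike.congr_fun (map_zero (leftAct Γ n.1 m.1)) (α.comp n m)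

/-- The right action of the completion at `B` on `𝒜(B, C)`: `(α γ)_{n,m} = α_{n,m} γ_m`. -/
instance homSpaceRightModule (Γ : Subalgebra k A) (s : Setoid (Cfs k Γ)) (B C : Quotient s) :
    Module (Completion s B)ᵐᵒᵖ (HomSpace Γ s B C) where
  smul γ α := ⟨fun n m => rightAct Γ n.1 m.1 (γ.unop.comp m) (α.comp n m), fun n n' m m' hn hm =>
    (trans_rightAct Γ hn hm _ _).trans
      (congrArg₂ (fun g x => rightAct Γ n'.1 m'.1 g x) (γ.unop.2 m m' hm) (α.2 n n' m m' hn hm))⟩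
  one_smul α := HomSpace.ext fun n m => rightAct_one Γ n.1 m.1 (α.comp n m)
  mul_smul γ δ α := HomSpace.ext fun n m =>
    rightAct_mul Γ n.1 m.1 (δ.unop.comp m) (γ.unop.comp m) (α.comp n m)
  smul_zero γ := HomSpace.ext fun n m => map_zero (rightAct Γ n.1 m.1 (γ.unop.comp m))
  smul_add γ α β := HomSpace.ext fun n m =>
    map_add (rightAct Γ n.1 m.1 (γ.unop.comp m)) (α.comp n m) (β.comp n m)
  add_smul γ δ α := HomSpace.ext fun n m =>
    DFunLike.congr_fun (map_add (rightAct Γ n.1 m.1) (γ.unop.comp m) (δ.unop.comp m))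
      (α.comp n m)
  zero_smul α := HomSpace.ext fun n m =>
    DFunLike.congr_fun (map_zero (rightAct Γ n.1 m.1)) (α.comp n m)

end Subalgebra

end HCBlock

namespace HCBlock

/-! ### Comaximality of distinct blocks, and finite codimension of words -/

section Blocks

variable {k : Type*} [Field k] {R : Type*} [Ring R] [Algebra k R]

/-! Everything reduces to the cyclic modules `P = A/Am` with `m ∈ W(B)`, because a nonzero vector
killed by `m` in a simple module `V` presents `V` as a quotient of `P`.

The key fact is that `P(B)` is finite-dimensional (`finite_blockSpace_quotient`). By strongness one
`n ∈ W(B)` kills `P(B)`, so `P(B)` embeds in a quotient of `A/(nA + Am)`. That space is a component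
of `𝒜(B, B)`, hence finitely generated over `Γ/n` (`finite_twoQuot`), and `Γ/n` is
finite-dimensional because `Γ` is noetherian (`finite_quotient_wordProd`).

Words of different blocks are comaximal, so an element of `Γ` congruent to `1` modulo a word can
push any vector of `P` into `P(B)` (`IsBlockModule.exists_smul_mem`). Hence a surjection `P → V`
maps `P(B)` onto `V(B)`, which gives (ii).

For (i), pairwise non-isomorphic simple quotients of one `P` with `B` in their support would cut out
a strictly descending chain of subspaces of `P(B)`, so each `m` gives finitely many
(`exists_equiv_of_sequence`). Every nonzero `V(B)` has a nonzero vector killed by a single member of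
`B` (`exists_ne_zero_killed`), and `B` is finite. -/

theorem sup_eq_top_of_ne {m m' : Cfs k R} (h : m ≠ m') : m.1 ⊔ m'.1 = ⊤ := by
  by_contra htop
  have h₁ := m.2.1
  have h₂ := m'.2.1
  have h₃ : (m.1 ⊔ m'.1).IsTwoSided := ⟨fun {a} b ha => by
    obtain ⟨x, hx, y, hy, rfl⟩ := Submodule.mem_sup.1 ha
    rw [add_mul]
    exact Submodule.add_mem_sup (m.1.mul_mem_right b hx) (m'.1.mul_mem_right b hy)⟩
  have e₁ := m.2.2.2.1 (m.1 ⊔ m'.1) h₃ le_sup_left htop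
  have e₂ := m'.2.2.2.1 (m.1 ⊔ m'.1) h₃ le_sup_right htop
  exact h (Subtype.ext (e₁.symm.trans e₂))

theorem mul_sup_eq_top {I I' J : Ideal R} [J.IsTwoSided] (h : I ⊔ J = ⊤) (h' : I' ⊔ J = ⊤) :
    I * I' ⊔ J = ⊤ := by
  rw [Ideal.eq_top_iff_one, Submodule.mem_sup] at *
  obtain ⟨i, hi, j, hj, e⟩ := h
  obtain ⟨i', hi', j', hj', e'⟩ := h'
  refine ⟨i * i', Ideal.mul_mem_mul hi hi', i * j' + j, J.add_mem (J.mul_mem_left i hj') hj, ?_⟩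
  rw [← add_assoc, ← mul_add, e', mul_one, e]

theorem wordProd_sup_eq_top {J : Ideal R} [J.IsTwoSided] (l : List (Cfs k R))
    (h : ∀ m ∈ l, m.1 ⊔ J = ⊤) : wordProd l ⊔ J = ⊤ := by
  induction l with
  | nil => exact top_sup_eq J
  | cons m l ih =>
    exact mul_sup_eq_top (h m List.mem_cons_self) (ih fun x hx => h x (List.mem_cons_of_mem m hx))

theorem words_sup_eq_top (s : Setoid (Cfs k R)) {B C : Quotient s} (hBC : B ≠ C) {I J : Ideal R}
    (hI : I ∈ words s B) (hJ : J ∈ words s C) : I ⊔ J = ⊤ := by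
  have := word_isTwoSided s C ⟨J, hJ⟩
  obtain ⟨l, hl, rfl⟩ := hI
  obtain ⟨l', hl', rfl⟩ := hJ
  refine wordProd_sup_eq_top l fun m hm => ?_
  have := m.2.1
  rw [sup_comm]
  refine wordProd_sup_eq_top l' fun m' hm' => sup_eq_top_of_ne ?_
  rintro rfl
  exact hBC ((hl _ hm).symm.trans (hl' _ hm'))

theorem wordProd_singleton_mem_words (s : Setoid (Cfs k R)) (m : Cfs k R) :
    wordProd [m] ∈ words s (Quotient.mk s m) :=
  ⟨[m], by simp, rfl⟩

/-- In a block module, some element of `R` congruent to `1` modulo a given product of members of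
`B` moves a given vector into the block space at `B`. -/
theorem IsBlockModule.exists_smul_mem {s : Setoid (Cfs k R)} {V : Type*} [AddCommGroup V]
    [Module R V] (hV : IsBlockModule s V) (B : Quotient s) {J : Ideal R} (hJ : J ∈ words s B)
    (y : V) : ∃ b : R, 1 - b ∈ J ∧ b • y ∈ blockSpace s V B := by
  classical
  have := word_isTwoSided s B ⟨J, hJ⟩
  have hy : y ∈ ⨆ C, blockSpace s V C := by
    rw [DirectSum.IsInternal.submodule_iSup_eq_top hV]; trivial
  -- The multiplier `c` is needed for sums: the second summand has to be corrected after the element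
  -- chosen for the first has already acted on it.
  suffices h : ∀ c : R, ∃ b : R, 1 - b ∈ J ∧ b • c • y ∈ blockSpace s V B by
    simpa using h 1
  induction hy using Submodule.iSup_induction' with
  | mem C y hy =>
    intro c
    by_cases hC : C = B
    · subst hC
      exact ⟨1, by simp, by simpa using Submodule.smul_mem _ c hy⟩
    · obtain ⟨I, hI, hIy⟩ := (blockSpace s V C).smul_mem c hy
      have htop := words_sup_eq_top s hC hI hJ
      rw [Ideal.eq_top_iff_one, Submodule.mem_sup] at htop
      obtain ⟨i, hi, j, hj, e⟩ := htop
      -- Writing `1 = i + j` with `i ∈ I`, `j ∈ J`, the element `i` annihilates this component and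
      -- is `1` modulo `J`.
      refine ⟨i, by rwa [← e, add_sub_cancel_left], ?_⟩
      rw [hIy i hi]
      exact Submodule.zero_mem _
  | zero => exact fun c => ⟨1, by simp, by simp⟩
  | add y z _ _ hy hz =>
    intro c
    obtain ⟨b, hb, hby⟩ := hy c
    obtain ⟨b', hb', hbz⟩ := hz (b * c)
    refine ⟨b' * b, ?_, ?_⟩
    · have : 1 - b' * b = (1 - b) + (1 - b') * b := by noncomm_ring
      rw [this]
      exact J.add_mem hb (J.mul_mem_right b hb')
    · rw [smul_add, smul_add, mul_smul, mul_smul]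
      refine Submodule.add_mem _ (Submodule.smul_mem _ _ hby) ?_
      rwa [← mul_smul b c z]

theorem smul_eq_self_of_one_sub_mem {V : Type*} [AddCommGroup V] [Module R V] {J : Ideal R} {w : V}
    (hw : ∀ x ∈ J, x • w = 0) {b : R} (hb : 1 - b ∈ J) : b • w = w := by
  have := hw _ hb
  rwa [sub_smul, one_smul, sub_eq_zero, eq_comm] at this

/-- A nonzero block space contains a nonzero vector killed by a single member of the block. -/
theorem exists_ne_zero_killed (s : Setoid (Cfs k R)) {V : Type*} [AddCommGroup V] [Module R V]
    {B : Quotient s} (h : blockSpace s V B ≠ ⊥) :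
    ∃ m : Cfs k R, Quotient.mk s m = B ∧ ∃ v : V, v ≠ 0 ∧ ∀ x ∈ m.1, x • v = 0 := by
  obtain ⟨v, ⟨I, ⟨l, hl, rfl⟩, hv⟩, hv0⟩ := Submodule.exists_mem_ne_zero_of_ne_bot h
  -- Peel off the leftmost factor: either the shorter word still kills `v`, or some `x • v ≠ 0` with
  -- `x` in it, and that vector is killed by the removed factor.
  induction l with
  | nil => exact absurd (by simpa using hv 1 trivial) hv0
  | cons m l ih =>
    by_cases hx : ∀ x ∈ wordProd l, x • v = 0
    · exact ih (fun n hn => hl n (List.mem_cons_of_mem m hn)) hx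
    · push Not at hx
      obtain ⟨x, hx, hxv⟩ := hx
      refine ⟨m, hl m List.mem_cons_self, x • v, hxv, fun y hy => ?_⟩
      rw [← mul_smul]
      exact hv _ (Ideal.mul_mem_mul hy hx)

/-- `R/IJ` is an extension of `R/J` by `J/IJ`, and finitely many left generators of `J` make `J/IJ`
a quotient of a finite power of `R/I`. -/
theorem finite_quotient_mul {I J : Ideal R} (hI : Module.Finite k (R ⧸ I))
    (hJ : Module.Finite k (R ⧸ J)) (hfg : J.FG) : Module.Finite k (R ⧸ I * J) := by
  obtain ⟨r, w, hw⟩ := Submodule.fg_iff_exists_fin_generating_family.1 hfg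
  have hwJ : ∀ i, w i ∈ J := fun i => hw ▸ Submodule.subset_span ⟨i, rfl⟩
  let f : Fin r → (R ⧸ I) →ₗ[k] (R ⧸ I * J) := fun i =>
    ((I.mapQ (I * J) (LinearMap.toSpanSingleton R R (w i)) fun x hx =>
      Ideal.mul_mem_mul hx (hwJ i)).restrictScalars k)
  let F : (Fin r → R ⧸ I) →ₗ[k] (R ⧸ I * J) := LinearMap.lsum k _ k f
  -- The range of `F` is `J/IJ`, so the quotient by it is an image of `R/J`.
  have hq : Module.Finite k ((R ⧸ I * J) ⧸ LinearMap.range F) := by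
    let g : R →ₗ[k] (R ⧸ I * J) ⧸ LinearMap.range F :=
      (LinearMap.range F).mkQ ∘ₗ (Submodule.mkQ (I * J)).restrictScalars k
    have hg : J.restrictScalars k ≤ LinearMap.ker g := by
      intro x hx
      have hx' : x ∈ Submodule.span R (Set.range w) := hw.symm ▸ hx
      obtain ⟨c, rfl⟩ := (Submodule.mem_span_range_iff_exists_fun R).1 hx'
      refine (Submodule.Quotient.mk_eq_zero _).2 ⟨fun i => Submodule.Quotient.mk (c i), ?_⟩
      simp only [F, LinearMap.lsum_apply, LinearMap.sum_apply, LinearMap.comp_apply,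
        LinearMap.restrictScalars_apply, map_sum]
      rfl
    let e : (R ⧸ J) →ₗ[k] _ := (J.restrictScalars k).liftQ g hg
    refine Module.Finite.of_surjective e ?_
    intro x
    obtain ⟨y, rfl⟩ := Submodule.mkQ_surjective _ x
    obtain ⟨z, rfl⟩ := Submodule.mkQ_surjective _ y
    exact ⟨Submodule.Quotient.mk z, rfl⟩
  exact Module.Finite.of_submodule_quotient (LinearMap.range F)

theorem finite_quotient_wordProd [IsNoetherianRing R] (l : List (Cfs k R)) :
    Module.Finite k (R ⧸ wordProd l) := by
  induction l with
  | nil =>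
    have : Subsingleton (R ⧸ wordProd ([] : List (Cfs k R))) :=
      Submodule.Quotient.subsingleton_iff.2 rfl
    infer_instance
  | cons m l ih => exact finite_quotient_mul m.2.2.2.2 ih (IsNoetherian.noetherian _)

end Blocks
end HCBlock

namespace HCBlock

/-! ### Finite-dimensionality of `A/(nA + Am)` and of the block space of `A/Am` -/

section Subalgebra

variable {k : Type*} [Field k] {A : Type*} [Ring A] [Algebra k A]

/-- The image of `a ∈ A` in `𝒜(B, C)`. -/
def HomSpace.of (Γ : Subalgebra k A) (s : Setoid (Cfs k Γ)) (B C : Quotient s) (a : A) :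
    HomSpace Γ s B C :=
  ⟨fun n m => twoMk Γ n.1 m.1 a, fun _ _ _ _ hn hm => trans_mk Γ hn hm a⟩

theorem HomSpace.comp_surjective (Γ : Subalgebra k A) (s : Setoid (Cfs k Γ)) {B C : Quotient s}
    (n : Word s C) (m : Word s B) :
    Function.Surjective fun α : HomSpace Γ s B C => α.comp n m := fun x => by
  obtain ⟨a, rfl⟩ := twoMk_surjective Γ n.1 m.1 x
  exact ⟨HomSpace.of Γ s B C a, rfl⟩

/-- The action map of `Γ/n` on a fixed element of `A/(nA + Am)`, as a `k`-linear map. -/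
def leftActLinear (Γ : Subalgebra k A) (n m : Ideal Γ) [n.IsTwoSided] (x : TwoQuot Γ n m) :
    (Γ ⧸ n) →ₗ[k] TwoQuot Γ n m where
  toFun g := leftAct Γ n m g x
  map_add' g h := by rw [map_add]; rfl
  map_smul' c g := by
    obtain ⟨g, rfl⟩ := Ideal.Quotient.mk_surjective g
    obtain ⟨a, rfl⟩ := twoMk_surjective Γ n m x
    change twoMk Γ n m (((c • g : Γ) : A) * a) = c • twoMk Γ n m ((g : A) * a)
    rw [← map_smul, ← smul_mul_assoc]
    rfl

/-- Each component of the limit is reached already by the images of elements of `A`, and the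
completion acts on it through `Γ/n`. Generators of the limit therefore project to generators over
the finite-dimensional algebra `Γ/n`. -/
theorem finite_twoQuot (Γ : Subalgebra k A) [IsNoetherianRing Γ] (s : Setoid (Cfs k Γ))
    {B C : Quotient s} [Module.Finite (Completion s C) (HomSpace Γ s B C)]
    (n : Word s C) (m : Word s B) : Module.Finite k (TwoQuot Γ n.1 m.1) := by
  have : Module.Finite k (Γ ⧸ n.1) := by
    obtain ⟨l, -, hl⟩ := n.2
    rw [← hl]
    exact finite_quotient_wordProd l
  obtain ⟨r, α, hα⟩ := Submodule.fg_iff_exists_fin_generating_family.1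
    (Module.Finite.fg_top : (⊤ : Submodule (Completion s C) (HomSpace Γ s B C)).FG)
  let F : (Fin r → Γ ⧸ n.1) →ₗ[k] TwoQuot Γ n.1 m.1 :=
    LinearMap.lsum k _ k fun i => leftActLinear Γ n.1 m.1 ((α i).comp n m)
  refine Module.Finite.of_surjective F fun x => ?_
  obtain ⟨β, rfl⟩ := HomSpace.comp_surjective Γ s n m x
  obtain ⟨c, rfl⟩ := (Submodule.mem_span_range_iff_exists_fun _).1
    (hα ▸ Submodule.mem_top : β ∈ Submodule.span _ (Set.range α))
  refine ⟨fun i => (c i).comp n, ?_⟩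
  let ev : HomSpace Γ s B C →+ TwoQuot Γ n.1 m.1 :=
    AddMonoidHom.mk' (fun β => β.comp n m) fun _ _ => rfl
  change _ = ev (∑ i, c i • α i)
  simp only [F, LinearMap.lsum_apply, LinearMap.sum_apply, LinearMap.comp_apply, map_sum]
  rfl

/-- The block space at `B` of a strong block module `A/Am`, `m` a product of members of `B`, is
finite-dimensional as soon as all `A/(nA + Am)` are. -/
theorem finite_blockSpace_quotient (Γ : Subalgebra k A) (s : Setoid (Cfs k Γ)) {B : Quotient s}
    {m : Ideal Γ} (hP : IsStrongBlockModule (R := Γ) s (A ⧸ leftIdeal Γ m))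
    (hfin : ∀ n ∈ words s B, Module.Finite k (TwoQuot Γ n m)) :
    Module.Finite k (blockSpace (R := Γ) s (A ⧸ leftIdeal Γ m) B) := by
  classical
  obtain ⟨hint, hstrong⟩ := hP
  obtain ⟨n, hn, hkill⟩ := hstrong B
  have := hfin n hn
  set X := blockSpace (R := Γ) s (A ⧸ leftIdeal Γ m) with hX
  set Q : Submodule Γ (A ⧸ leftIdeal Γ m) := ⨆ C ≠ B, X C with hQ
  have hdisj : Disjoint (X B) Q := DirectSum.IsInternal.submodule_iSupIndep hint B
  have hsup : X B ⊔ Q = ⊤ := by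
    rw [eq_top_iff, ← DirectSum.IsInternal.submodule_iSup_eq_top hint]
    refine iSup_le fun C => ?_
    by_cases hC : C = B
    · exact hC ▸ le_sup_left
    · exact le_sup_of_le_right (le_iSup₂_of_le C hC le_rfl)
  -- Since `n` kills the `B`-component, it sends the whole module into the sum `Q` of the other
  -- components; hence `A → (A/Am)/Q` factors through `A/(nA + Am)`.
  have hnQ : ∀ x ∈ n, ∀ y : A ⧸ leftIdeal Γ m, x • y ∈ Q := by
    intro x hx y
    obtain ⟨p, hp, q, hq, rfl⟩ := Submodule.mem_sup.1 (hsup ▸ Submodule.mem_top : y ∈ X B ⊔ Q)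
    rw [smul_add, hkill x hx p hp, zero_add]
    exact Q.smul_mem x hq
  let g : A →ₗ[k] (A ⧸ leftIdeal Γ m) ⧸ Q :=
    Q.mkQ.restrictScalars k ∘ₗ (leftIdeal Γ m).mkQ.restrictScalars k
  have hg : twoSum Γ n m ≤ LinearMap.ker g := by
    refine twoSum_induction Γ _ (fun x hx a => ?_) (fun x hx a => ?_)
    · exact (Submodule.Quotient.mk_eq_zero _).2 (hnQ x hx (Submodule.Quotient.mk a))
    · have : (leftIdeal Γ m).mkQ (a * (x : A)) = 0 :=
        (Submodule.Quotient.mk_eq_zero _).2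
          (Submodule.smul_mem _ a (Submodule.subset_span ⟨x, hx, rfl⟩))
      change Q.mkQ ((leftIdeal Γ m).mkQ (a * (x : A))) = 0
      rw [this, map_zero]
  have hfinQ : Module.Finite k ((A ⧸ leftIdeal Γ m) ⧸ Q) := by
    let e : TwoQuot Γ n m →ₗ[k] (A ⧸ leftIdeal Γ m) ⧸ Q := (twoSum Γ n m).liftQ g hg
    refine Module.Finite.of_surjective e fun x => ?_
    obtain ⟨y, rfl⟩ := Submodule.mkQ_surjective _ x
    obtain ⟨a, rfl⟩ := Submodule.mkQ_surjective _ y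
    exact ⟨twoMk Γ n m a, rfl⟩
  refine Module.Finite.of_injective ((Q.mkQ ∘ₗ (X B).subtype).restrictScalars k) ?_
  rw [← LinearMap.ker_eq_bot, LinearMap.ker_eq_bot']
  rintro ⟨x, hx⟩ hx0
  have hxQ : x ∈ Q := (Submodule.Quotient.mk_eq_zero _).1 hx0
  exact Subtype.ext (Submodule.disjoint_def.1 hdisj x hx hxQ)

/-! ### Simple quotients of `A/Am` -/

/-- The map `A/Am → V` sending the class of `1` to a vector `v` killed by `m`. -/
def liftVector (Γ : Subalgebra k A) (m : Ideal Γ) {V : Type*} [AddCommGroup V] [Module A V] (v : V)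
    (hv : ∀ x ∈ m, x • v = 0) : (A ⧸ leftIdeal Γ m) →ₗ[A] V :=
  (leftIdeal Γ m).liftQ (LinearMap.toSpanSingleton A V v) <| Submodule.span_le.2 <| by
    rintro _ ⟨x, hx, rfl⟩
    exact hv x hx

theorem liftVector_ne_zero (Γ : Subalgebra k A) (m : Ideal Γ) {V : Type*} [AddCommGroup V]
    [Module A V] {v : V} (hv : ∀ x ∈ m, x • v = 0) (hv0 : v ≠ 0) : liftVector Γ m v hv ≠ 0 := by
  intro h
  apply hv0
  have : (1 : A) • v = 0 := LinearMap.congr_fun h (Submodule.Quotient.mk 1)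
  rwa [one_smul] at this

/-- If finitely many maps `φ i` to simple modules have common kernel inside the kernel of a nonzero
map `ψ` to a simple module, then that module is isomorphic to the target of some `φ i`. -/
theorem exists_equiv_of_iInf_ker_le {P V ι : Type*} {W : ι → Type*} [AddCommGroup P] [Module A P]
    [AddCommGroup V] [Module A V] [IsSimpleModule A V] [∀ i, AddCommGroup (W i)]
    [∀ i, Module A (W i)] [∀ i, IsSimpleModule A (W i)] (φ : ∀ i, P →ₗ[A] W i) {ψ : P →ₗ[A] V}
    (hψ : ψ ≠ 0) (T : Finset ι) (h : ⨅ i ∈ T, LinearMap.ker (φ i) ≤ LinearMap.ker ψ) :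
    ∃ i ∈ T, Nonempty (W i ≃ₗ[A] V) := by
  classical
  induction T using Finset.induction_on with
  | empty =>
    refine absurd (LinearMap.ext fun x => ?_) hψ
    exact h (by simp)
  | insert t T ht ih =>
    set K := ⨅ i ∈ T, LinearMap.ker (φ i) with hK
    by_cases hT : K ≤ LinearMap.ker ψ
    · obtain ⟨i, hi, e⟩ := ih hT
      exact ⟨i, Finset.mem_insert_of_mem hi, e⟩
    rw [Finset.iInf_insert] at h
    -- On `K` the kernel of `φ t` lies in that of `ψ`, which is nonzero there. So `φ t` is nonzero
    -- on `K`, hence onto, and `ψ` induces a nonzero map `W t → V`, an isomorphism by Schur.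
    have hker : LinearMap.ker (φ t ∘ₗ K.subtype) ≤ LinearMap.ker (ψ ∘ₗ K.subtype) :=
      fun x hx => h ⟨hx, x.2⟩
    have hψK : ψ ∘ₗ K.subtype ≠ 0 := fun h0 =>
      hT fun x hx => LinearMap.congr_fun h0 ⟨x, hx⟩
    have hφK : φ t ∘ₗ K.subtype ≠ 0 := fun h0 =>
      hψK (LinearMap.ext fun x => hker (LinearMap.congr_fun h0 x))
    let e := LinearMap.quotKerEquivOfSurjective _ (LinearMap.surjective_of_ne_zero hφK)
    let q := (LinearMap.ker (φ t ∘ₗ K.subtype)).liftQ (ψ ∘ₗ K.subtype) hker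
    have hq : q ∘ₗ e.symm.toLinearMap ≠ 0 := fun h0 => hψK <| LinearMap.ext fun x => by
      have := LinearMap.congr_fun h0 (e (Submodule.Quotient.mk x))
      simpa [q] using this
    exact ⟨t, Finset.mem_insert_self t T,
      ⟨LinearEquiv.ofBijective _ (LinearMap.bijective_of_ne_zero hq)⟩⟩

theorem map_mem_blockSpace (Γ : Subalgebra k A) (s : Setoid (Cfs k Γ)) {B : Quotient s}
    {P V : Type*} [AddCommGroup P] [Module A P] [AddCommGroup V] [Module A V] (f : P →ₗ[A] V)
    {x : P} (hx : x ∈ blockSpace (R := Γ) s P B) : f x ∈ blockSpace (R := Γ) s V B := by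
  obtain ⟨I, hI, hx⟩ := hx
  refine ⟨I, hI, fun y hy => ?_⟩
  have := congrArg f (hx y hy)
  rwa [map_zero, Subalgebra.smul_def, map_smul] at this

/-- A vector of `V(B)` hit by an `A`-submodule of a block module is hit by a vector of that
submodule lying in the block space at `B`. -/
theorem exists_mem_blockSpace_of_map (Γ : Subalgebra k A) {s : Setoid (Cfs k Γ)} {B : Quotient s}
    {P V : Type*} [AddCommGroup P] [Module A P] [AddCommGroup V] [Module A V]
    (hP : IsBlockModule (R := Γ) s P) (f : P →ₗ[A] V) (K : Submodule A P) {y : P} (hy : y ∈ K)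
    (hfy : f y ∈ blockSpace (R := Γ) s V B) :
    ∃ x ∈ K, x ∈ blockSpace (R := Γ) s P B ∧ f x = f y := by
  obtain ⟨I, hI, hw⟩ := hfy
  -- As `b` is `1` modulo `I` and `I` kills `f y`, replacing `y` by `b • y` does not change the
  -- image.
  obtain ⟨b, hb, hby⟩ := hP.exists_smul_mem B hI y
  refine ⟨b • y, ?_, hby, ?_⟩
  · rw [Subalgebra.smul_def]
    exact K.smul_mem _ hy
  · rw [Subalgebra.smul_def, map_smul, ← Subalgebra.smul_def]
    exact smul_eq_self_of_one_sub_mem hw hb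

/-- A block `A`-module whose block space at `B` is finite-dimensional has no infinite sequence of
pairwise non-isomorphic simple quotients with `B` in their support. -/
theorem exists_equiv_of_sequence (Γ : Subalgebra k A) {s : Setoid (Cfs k Γ)} {B : Quotient s}
    {P : Type*} [AddCommGroup P] [Module k P] [Module A P] [IsScalarTower k A P]
    (hP : IsBlockModule (R := Γ) s P)
    [Module.Finite k (blockSpace (R := Γ) s P B)]
    {W : ℕ → Type*} [∀ i, AddCommGroup (W i)]
    [∀ i, Module A (W i)] [∀ i, IsSimpleModule A (W i)] (φ : ∀ i, P →ₗ[A] W i)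
    (hφ : ∀ i, φ i ≠ 0) (hW : ∀ i, blockSpace (R := Γ) s (W i) B ≠ ⊥) :
    ∃ i j, i < j ∧ Nonempty (W i ≃ₗ[A] W j) := by
  by_contra! hno
  let X := blockSpace (R := Γ) s P B
  let K : ℕ → Submodule A P := fun n => ⨅ i ∈ Finset.range n, LinearMap.ker (φ i)
  -- The descending chain `K n ∩ P(B)`, made monotone by the order dual so that it stabilizes by
  -- finite-dimensionality.
  let D : ℕ →o (Submodule k X)ᵒᵈ :=
    ⟨fun n => OrderDual.toDual
      (((K n).restrictScalars k).comap (X.subtype.restrictScalars k)), fun a b hab => by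
        have hK : K b ≤ K a := biInf_mono fun i hi => Finset.range_mono hab hi
        exact fun x hx => hK hx⟩
  obtain ⟨n, hn⟩ := IsArtinian.monotone_stabilizes D
  have hstab := hn (n + 1) n.le_succ
  have hnot : ¬ K n ≤ LinearMap.ker (φ n) := fun hle => by
    obtain ⟨i, hi, ⟨e⟩⟩ := exists_equiv_of_iInf_ker_le φ (hφ n) (Finset.range n) hle
    exact (hno i n (Finset.mem_range.1 hi)).false e
  have hne : φ n ∘ₗ (K n).subtype ≠ 0 := fun h0 =>
    hnot fun x hx => LinearMap.congr_fun h0 ⟨x, hx⟩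
  -- A nonzero `w` in the block space of `W n` lifts to `K n ∩ P(B)`; the lift is not in `K (n +
  -- 1)`, contradicting stability.
  obtain ⟨w, hw, hw0⟩ := Submodule.exists_mem_ne_zero_of_ne_bot (hW n)
  obtain ⟨y, rfl⟩ := LinearMap.surjective_of_ne_zero hne w
  obtain ⟨x, hxK, hxB, hx⟩ := exists_mem_blockSpace_of_map Γ hP (φ n) (K n) y.2 hw
  have hmem : (⟨x, hxB⟩ : X) ∈ OrderDual.ofDual (D n) := hxK
  rw [hstab] at hmem
  have hxK' : x ∈ K (n + 1) := hmem
  have hx0 : φ n x = 0 :=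
    (Submodule.mem_iInf _).1 ((Submodule.mem_iInf _).1 hxK' n) (Finset.self_mem_range_succ n)
  exact hw0 (hx.symm.trans hx0)

end Subalgebra

end HCBlock

/-! ### The finiteness theorem -/

theorem mainTheorem3 {k : Type u} [Field k] {A : Type v} [Ring A] [Algebra k A]
    (Γ : Subalgebra k A) [IsNoetherianRing Γ] [IsNoetherianRing Γᵐᵒᵖ]
    (s : Setoid (HCBlock.Cfs k Γ)) (hΓ : HCBlock.IsStrongHCBlockSubalgebra Γ s)
    (B : Quotient s) (hB : {m : HCBlock.Cfs k Γ | Quotient.mk s m = B}.Finite)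
    (hleft : Module.Finite (HCBlock.Completion s B) (HCBlock.HomSpace Γ s B B))
    (hright : Module.Finite (HCBlock.Completion s B)ᵐᵒᵖ (HCBlock.HomSpace Γ s B B)) :
    {c : Quotient (CategoryTheory.isIsomorphicSetoid (ModuleCat.{w} A)) |
        ∃ V : ModuleCat.{w} A, c = Quotient.mk _ V ∧ IsSimpleModule A V ∧
          HCBlock.IsHCBlockModule Γ s V ∧ B ∈ HCBlock.supp (R := Γ) s V}.Finite ∧
      ∀ (V : Type w) [AddCommGroup V] [Module k V] [Module A V] [IsScalarTower k A V],
        IsSimpleModule A V → HCBlock.IsHCBlockModule Γ s V →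
          FiniteDimensional k (HCBlock.blockSpace (R := Γ) s V B) := by
  have hfin : ∀ m ∈ HCBlock.words s B,
      Module.Finite k (HCBlock.blockSpace (R := Γ) s (A ⧸ HCBlock.leftIdeal Γ m) B) :=
    fun m hm => HCBlock.finite_blockSpace_quotient Γ s (hΓ.1 B m hm) fun n hn =>
      HCBlock.finite_twoQuot Γ s ⟨n, hn⟩ ⟨m, hm⟩
  constructor
  · have hone : ∀ m ∈ HCBlock.words s B,
        {c : Quotient (CategoryTheory.isIsomorphicSetoid (ModuleCat.{w} A)) |
          ∃ V : ModuleCat.{w} A, c = Quotient.mk _ V ∧ IsSimpleModule A V ∧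
            HCBlock.blockSpace (R := Γ) s V B ≠ ⊥ ∧
              ∃ v : V, v ≠ 0 ∧ ∀ x ∈ m, x • v = 0}.Finite := by
      intro m hm
      by_contra hinf
      let f := Set.Infinite.natEmbedding _ hinf
      choose V hV hsimple hsupp v hv0 hv using fun i => (f i).2
      have := hfin m hm
      obtain ⟨i, j, hij, ⟨e⟩⟩ := HCBlock.exists_equiv_of_sequence Γ (hΓ.1 B m hm).1
        (fun i => HCBlock.liftVector Γ m (v i) (hv i))
        (fun i => HCBlock.liftVector_ne_zero Γ m (hv i) (hv0 i)) hsupp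
      refine hij.ne (f.injective (Subtype.ext ?_))
      rw [hV i, hV j]
      exact Quotient.sound ⟨e.toModuleIso⟩
    -- Words of length one suffice, and there are finitely many since `B` is finite.
    refine (hB.biUnion fun m hm =>
      hone (HCBlock.wordProd [m]) (hm ▸ HCBlock.wordProd_singleton_mem_words s m)).subset ?_
    rintro c ⟨V, hc, hsimple, -, hsupp⟩
    obtain ⟨m, hm, v, hv0, hv⟩ := HCBlock.exists_ne_zero_killed s hsupp
    have := m.2.1
    exact Set.mem_biUnion hm
      -- `wordProd [m]` is `m * ⊤`, contained in `m` because `m` is two-sided.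
      ⟨V, hc, hsimple, hsupp, v, hv0, fun x hx => hv x (Ideal.mul_le_left hx)⟩
  · intro V _ _ _ _ hsimple _
    by_cases hbot : HCBlock.blockSpace (R := Γ) s V B = ⊥
    · rw [hbot]
      infer_instance
    obtain ⟨v, ⟨m, hm, hv⟩, hv0⟩ := Submodule.exists_mem_ne_zero_of_ne_bot hbot
    have := hfin m hm
    let g := HCBlock.liftVector Γ m v hv
    let F : HCBlock.blockSpace (R := Γ) s (A ⧸ HCBlock.leftIdeal Γ m) B →ₗ[k]
        HCBlock.blockSpace (R := Γ) s V B :=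
      { toFun := fun x => ⟨g x, HCBlock.map_mem_blockSpace Γ s g x.2⟩
        map_add' := fun x y => Subtype.ext (map_add g x.1 y.1)
        map_smul' := fun c x => Subtype.ext ((g.restrictScalars k).map_smul c x.1) }
    -- The finite-dimensional block space of `A/Am` maps onto `V(B)`: lift a vector arbitrarily,
    -- then correct the lift into the block space.
    refine Module.Finite.of_surjective F fun w => ?_
    obtain ⟨y, hy⟩ :=
      LinearMap.surjective_of_ne_zero (HCBlock.liftVector_ne_zero Γ m hv hv0) w.1
    obtain ⟨x, -, hx, hxy⟩ := HCBlock.exists_mem_blockSpace_of_map Γ (hΓ.1 B m hm).1 g ⊤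
      (Submodule.mem_top (x := y)) (hy.symm ▸ w.2)
    exact ⟨⟨x, hx⟩, Subtype.ext (hxy.trans hy)⟩
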